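/- In a $k$-party quantum simultaneous message-passing (SMP) protocol on $n$-bit inputs, each player $\ell\in[k]$ holds $x_\ell\in\{0,1\}^n$ and, knowing only $x_\ell$ (there is no shared randomness and no shared entanglement), sends a quantum state of $q_\ell$ qubits to a referee. The referee does not know the inputs; it measures the joint state it receives and produces an output from the outcome. The communication cost is $\sum_\ell q_\ell$. The protocol has bounded error if on every input the output is correct with probability at least $2/3$. The problem $\mathrm{GroupByEQ}_{k,n}$ asks for the partition of $[k]$ in which $i$ and $j$ lie in a common part if and only if $x_i=x_j$. **Theorem.** There is a universal constant $C>0$ such that the following hold. 1. For all $k$ and all $n\ge 2$ there is a bounded-error quantum SMP protocol for $\mathrm{GroupByEQ}_{k,n}$ with communication cost at most $C\,k\log k\log n$. 2. For all $k$ and all $n\ge 2$, there are bounded-error quantum SMP protocols with communication cost at most $C\,k\log k\log n$ for each of the following problems: (a) $\mathrm{AllEQ}_{k,n}$: decide whether all inputs $x_1,\dots,x_k$ are equal; (b) $\mathrm{ExistsEQ}_{k,n}$: decide whether there are $i\ne j$ with $x_i=x_j$; (c) for any real $p\ge 0$, compute exactly the frequency moment $F_p=\sum_{w\in\{0,1\}^n}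 (f_w)^p$, where $f_w$ is the number of players whose input is $w$ and only the strings $w$ with $f_w>0$ are counted (so that $F_0$ is the number of distinct inputs). 3. For all $k$, there is a bounded-error quantum SMP protocol with communication cost at most $C\,k\log^2 k$ that decides whether a graph $G$ on the node set $[k]$ contains an induced path with two edges ($P_3$), where the player $v$ is given the neighborhood vector $\nu_v\in\{0,1\}^k$ of the node $v$, that is, $\nu_v[u]=1$ if and only if $\{u,v\}$ is an edge of $G$ (the number-in-hand network model). For $k=0$, read $k\log k$ and $k\log^2 k$ as $0$. -/

import Mathlib

/-- The computational basis of a register of `q` qubits: all classical `q`-bit strings. -/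
abbrev QubitBasis (q : ℕ) : Type := Fin q → Bool

/-- A pure state of `q` qubits: a unit vector of `ℂ ^ (2 ^ q)`. -/
structure QubitState (q : ℕ) where
  amp : EuclideanSpace ℂ (QubitBasis q)
  norm_amp : ‖amp‖ = 1

open scoped ComplexOrder in
/-- A quantum simultaneous message-passing protocol with `k` players holding `n`-bit inputs, in
which the referee outputs an element of `S`. There is no shared randomness and no shared
entanglement: player `ℓ`, knowing only its own input, prepares the state of `qubits ℓ` fresh qubits
and sends these to the referee. The referee, who does not know the inputs, performs a quantum
measurement with finitely many outcomes (a POVM `effect`) jointly on all the qubits received, and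
its output is a function of the outcome. -/
structure QuantumSMP (k n : ℕ) (S : Type) where
  /-- The number of qubits sent by each player. -/
  qubits : Fin k → ℕ
  /-- The message of each player, as a function of its own input. -/
  message : (l : Fin k) → (Fin n → Bool) → QubitState (qubits l)
  /-- The number of outcomes of the measurement of the referee. -/
  outcomes : ℕ
  /-- The positive operators of the measurement. A basis vector of the joint register consists of
  a basis vector of the register of each player. -/
  effect : Fin outcomes →
    Matrix ((l : Fin k) → QubitBasis (qubits l)) ((l : Fin k) → QubitBasis (qubits l)) ℂ
  effect_posSemidef : ∀ w, (effect w).PosSemidef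
  effect_sum : ∑ w, effect w = 1
  /-- The output of the referee, as a function of the outcome. -/
  output : Fin outcomes → S

namespace QuantumSMP

variable {k n : ℕ} {S : Type}

/-- The communication cost: the total number of qubits sent by the players. -/
def cost (P : QuantumSMP k n S) : ℕ := ∑ l, P.qubits l

/-- The joint state received by the referee on input `x`: the tensor product of the messages. -/
noncomputable def jointState (P : QuantumSMP k n S) (x : Fin k → Fin n → Bool) :
    ((l : Fin k) → QubitBasis (P.qubits l)) → ℂ :=
  fun b => ∏ l, (P.message l (x l)).amp (b l)

/-- The probability `⟨ψ| M_w |ψ⟩` of the measurement outcome `w` on input `x`. -/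
noncomputable def outcomeProb (P : QuantumSMP k n S) (x : Fin k → Fin n → Bool)
    (w : Fin P.outcomes) : ℝ :=
  (star (P.jointState x) ⬝ᵥ (P.effect w).mulVec (P.jointState x)).re

open Classical in
/-- The probability that on input `x` the output of the referee satisfies `good`. -/
noncomputable def prob (P : QuantumSMP k n S) (x : Fin k → Fin n → Bool) (good : S → Prop) : ℝ :=
  ∑ w with good (P.output w), P.outcomeProb x w

/-- `P` is a bounded-error protocol for the problem in which, on input `x`, the correct outputs are
the `s` with `correct x s`. -/
def Solves (P : QuantumSMP k n S) (correct : (Fin k → Fin n → Bool) → S → Prop) : Prop :=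
  ∀ x : Fin k → Fin n → Bool, 2 / 3 ≤ P.prob x (correct x)

end QuantumSMP

/-- The neighborhood vector of the node `v`. -/
noncomputable def neighborhoodVector {k : ℕ} (G : SimpleGraph (Fin k)) (v : Fin k) :
    Fin k → Bool :=
  open Classical in fun u => decide (G.Adj v u)

/-- `P` is a bounded-error protocol in the number-in-hand network model for the graph problem in
which, on the graph `G`, the correct outputs are the `s` with `correct G s`. The players are the
nodes of `G`, and the input of the player `v` is the neighborhood vector of `v`. -/
def QuantumSMP.SolvesNIH {k : ℕ} {S : Type} (P : QuantumSMP k k S)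
    (correct : SimpleGraph (Fin k) → S → Prop) : Prop :=
  ∀ G : SimpleGraph (Fin k), 2 / 3 ≤ P.prob (neighborhoodVector G) (correct G)

/-- The partition `Q` of the set of players is the correct output of `GroupByEQ` on input `x`: two
players lie in a common part if and only if their inputs are equal. -/
def IsGroupByEQ {k n : ℕ} (x : Fin k → Fin n → Bool)
    (Q : Finpartition (Finset.univ : Finset (Fin k))) : Prop :=
  ∀ i j : Fin k, (∃ t ∈ Q.parts, i ∈ t ∧ j ∈ t) ↔ x i = x j

/-- The bit `b` is the correct output of `AllEQ` on input `x`. -/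
def IsAllEQ {k n : ℕ} (x : Fin k → Fin n → Bool) (b : Bool) : Prop :=
  b = true ↔ ∀ i j : Fin k, x i = x j

/-- The bit `b` is the correct output of `ExistsEQ` on input `x`. -/
def IsExistsEQ {k n : ℕ} (x : Fin k → Fin n → Bool) (b : Bool) : Prop :=
  b = true ↔ ∃ i j : Fin k, i ≠ j ∧ x i = x j

/-- The number of players whose input is `w`. -/
def frequency {k n : ℕ} (x : Fin k → Fin n → Bool) (w : Fin n → Bool) : ℕ :=
  Finset.card {l : Fin k | x l = w}

/-- The `p`-th frequency moment. Only the strings that occur contribute, so that the `0`-th moment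
is the number of distinct inputs. -/
noncomputable def frequencyMoment {k n : ℕ} (p : ℝ) (x : Fin k → Fin n → Bool) : ℝ :=
  ∑ w with frequency x w ≠ 0, (frequency x w : ℝ) ^ p

/-- The bit `b` tells correctly whether `G` contains an induced path with two edges. -/
def IsInducedP3Answer {k : ℕ} (G : SimpleGraph (Fin k)) (b : Bool) : Prop :=
  b = true ↔ Nonempty (SimpleGraph.pathGraph 3 ↪g G)

/-!
Each player sends `O(log k)` copies of the quantum fingerprints, on `O(log n)` qubits each, of a few
strings computed from its input. Swap tests on the copies then reveal whether two given strings are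
equal with a disturbance that is polynomially small in `k`, so the referee can perform the tests for
all pairs of strings one after the other and learns the whole equality pattern. This pattern
determines the answer to each of the equality problems.

A graph has no induced path with two edges if and only if it is a disjoint union of cliques, that
is, the complement of a complete multipartite graph; this holds if and only if every node `v` shares
its closed neighborhood with exactly `deg v + 1` nodes. An equality pattern shows it: the referee
learns the degrees too once the players send fingerprints of encodings of their degrees and of
their names.
-/

open Matrix WithLp

section Measurements

variable {B : Type*} [Fintype B]

theorem star_dotProduct_self (v : B → ℂ) : star v ⬝ᵥ v = (‖toLp 2 v‖ ^ 2 : ℝ) := by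
  rw [dotProduct_comm, ← EuclideanSpace.inner_toLp_toLp, inner_self_eq_norm_sq_to_K]
  norm_cast

theorem norm_toLp_comp_equiv {B' : Type*} [Fintype B'] (e : B' ≃ B) (v : B → ℂ) :
    ‖toLp 2 (v ∘ e)‖ = ‖toLp 2 v‖ :=
  (LinearIsometryEquiv.piLpCongrLeft 2 ℂ ℂ e.symm).norm_map (toLp 2 v)

theorem norm_toLp_mulVec_sq (A : Matrix B B ℂ) (v : B → ℂ) :
    ‖toLp 2 (A *ᵥ v)‖ ^ 2 = (star v ⬝ᵥ (Aᴴ * A) *ᵥ v).re := by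
  rw [← Complex.ofReal_re (‖toLp 2 (A *ᵥ v)‖ ^ 2), ← star_dotProduct_self, star_mulVec,
    ← dotProduct_mulVec, mulVec_mulVec]

variable [DecidableEq B] {Ω Ω' τ : Type*} [Fintype Ω] [Fintype Ω']

/-- A quantum measurement with outcomes in `Ω`, given by its measurement (Kraus) operators: the
outcome `w` has probability `‖A w ψ‖ ^ 2` and leaves the state `A w ψ`, up to normalization. -/
def IsMeasurement (A : Ω → Matrix B B ℂ) : Prop := ∑ w, (A w)ᴴ * A w = 1

namespace IsMeasurement

variable {A : Ω → Matrix B B ℂ} {A' : Ω' → Matrix B B ℂ}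

theorem sum_norm_sq (hA : IsMeasurement A) (v : B → ℂ) :
    ∑ w, ‖toLp 2 (A w *ᵥ v)‖ ^ 2 = ‖toLp 2 v‖ ^ 2 := by
  simp only [norm_toLp_mulVec_sq]
  rw [← Complex.re_sum, ← dotProduct_sum, ← sum_mulVec, hA, one_mulVec, star_dotProduct_self,
    Complex.ofReal_re]

theorem norm_mulVec_le (hA : IsMeasurement A) (w : Ω) (v : B → ℂ) :
    ‖toLp 2 (A w *ᵥ v)‖ ≤ ‖toLp 2 v‖ := by
  rw [← sq_le_sq₀ (norm_nonneg _) (norm_nonneg _), ← hA.sum_norm_sq v]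
  exact Finset.single_le_sum (f := fun w => ‖toLp 2 (A w *ᵥ v)‖ ^ 2) (fun _ _ => by positivity)
    (Finset.mem_univ w)

theorem comp_equiv (hA : IsMeasurement A) (e : Ω' ≃ Ω) : IsMeasurement (A ∘ e) :=
  (e.sum_comp fun w => (A w)ᴴ * A w).trans hA

theorem mul (hA : IsMeasurement A) (hA' : IsMeasurement A') :
    IsMeasurement fun w : Ω × Ω' => A w.1 * A' w.2 := by
  have hinner : ∀ w', ∑ w, (A w * A' w')ᴴ * (A w * A' w') = (A' w')ᴴ * A' w' := fun w' => by
    simp only [conjTranspose_mul, Matrix.mul_assoc, ← Matrix.mul_sum]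
    simp only [← Matrix.mul_assoc, ← Matrix.sum_mul]
    rw [hA, Matrix.mul_one]
  rw [IsMeasurement, Fintype.sum_prod_type_right, ← hA']
  exact Finset.sum_congr rfl fun w' _ => hinner w'

theorem exists_sequential_fin {N : ℕ} (K : Fin N → Ω → Matrix B B ℂ)
    (hK : ∀ t, IsMeasurement (K t)) :
    ∃ A : (Fin N → Ω) → Matrix B B ℂ, IsMeasurement A ∧ ∀ w ψ,
      ‖toLp 2 (A w *ᵥ ψ - ψ)‖ ≤ ∑ t, ‖toLp 2 (K t (w t) *ᵥ ψ - ψ)‖ := by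
  induction N with
  | zero => exact ⟨fun _ => 1, by simp [IsMeasurement], by simp⟩
  | succ N ih =>
    obtain ⟨A, hA, hdist⟩ := ih (Fin.tail K) fun t => hK _
    refine ⟨_, ((hK 0).mul hA).comp_equiv (Fin.consEquiv fun _ => Ω).symm, fun w ψ => ?_⟩
    change ‖toLp 2 ((K 0 (w 0) * A (Fin.tail w)) *ᵥ ψ - ψ)‖ ≤ _
    have hsplit : (K 0 (w 0) * A (Fin.tail w)) *ᵥ ψ - ψ =
        K 0 (w 0) *ᵥ (A (Fin.tail w) *ᵥ ψ - ψ) + (K 0 (w 0) *ᵥ ψ - ψ) := by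
      rw [mulVec_sub, mulVec_mulVec, sub_add_sub_cancel]
    rw [Fin.sum_univ_succ, hsplit, toLp_add, add_comm ‖_‖]
    exact (norm_add_le _ _).trans
      (add_le_add_left (((hK 0).norm_mulVec_le _ _).trans (hdist _ ψ)) _)

/-- A union bound for disturbances, which holds because measurement operators are contractions. -/
theorem exists_sequential [Fintype τ] [DecidableEq τ] (K : τ → Ω → Matrix B B ℂ)
    (hK : ∀ t, IsMeasurement (K t)) :
    ∃ A : (τ → Ω) → Matrix B B ℂ, IsMeasurement A ∧ ∀ w ψ,
      ‖toLp 2 (A w *ᵥ ψ - ψ)‖ ≤ ∑ t, ‖toLp 2 (K t (w t) *ᵥ ψ - ψ)‖ := by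
  let e := Fintype.equivFin τ
  obtain ⟨A, hA, hdist⟩ := exists_sequential_fin (K ∘ e.symm) fun t => hK _
  refine ⟨_, hA.comp_equiv (e.arrowCongr (Equiv.refl Ω)), fun w ψ => ?_⟩
  rw [← e.symm.sum_comp]
  exact hdist (w ∘ e.symm) ψ

end IsMeasurement

/-- The two-outcome measurement that tests whether a state lies in the range of the projection
`Q`. -/
def projectiveTest (Q : Matrix B B ℂ) (a : Bool) : Matrix B B ℂ := if a then Q else 1 - Q

theorem isMeasurement_projectiveTest {Q : Matrix B B ℂ} (hQ : IsStarProjection Q) :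
    IsMeasurement (projectiveTest Q) := by
  have hsq : ∀ {P : Matrix B B ℂ}, IsStarProjection P → Pᴴ * P = P := fun hP => by
    rw [← star_eq_conjTranspose, hP.isSelfAdjoint.star_eq, hP.isIdempotentElem.eq]
  simp only [IsMeasurement, projectiveTest, Fintype.sum_bool, if_true, Bool.false_eq_true, if_false,
    hsq hQ, hsq hQ.one_sub, add_sub_cancel]

end Measurements

section ProductStates

variable {ι : Type*} [Fintype ι] {B : ι → Type*}

/-- The tensor product of the states `φ i`, as a state of the joint register. -/
def productState (φ : ∀ i, B i → ℂ) : (∀ i, B i) → ℂ := fun b => ∏ i, φ i (b i)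

/-- The tensor product of the operators `A i`, acting on the joint register. -/
def productOperator (A : ∀ i, Matrix (B i) (B i) ℂ) : Matrix (∀ i, B i) (∀ i, B i) ℂ :=
  of fun b b' => ∏ i, A i (b i) (b' i)

theorem star_productOperator (A : ∀ i, Matrix (B i) (B i) ℂ) :
    star (productOperator A) = productOperator fun i => star (A i) := by
  ext b b'
  simp only [star_apply, productOperator, of_apply, star_prod]

variable [DecidableEq ι] [∀ i, Fintype (B i)]

theorem star_productState_dotProduct (φ χ : ∀ i, B i → ℂ) :
    star (productState φ) ⬝ᵥ productState χ = ∏ i, star (φ i) ⬝ᵥ χ i := by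
  simp only [dotProduct, productState, Pi.star_apply, star_prod, ← Finset.prod_mul_distrib]
  exact (Fintype.prod_sum fun i d => star (φ i d) * χ i d).symm

theorem norm_productState (φ : ∀ i, B i → ℂ) :
    ‖toLp 2 (productState φ)‖ = ∏ i, ‖toLp 2 (φ i)‖ := by
  rw [← sq_eq_sq₀ (by positivity) (by positivity), ← Finset.prod_pow]
  have h := star_productState_dotProduct φ φ
  simp only [star_dotProduct_self] at h
  exact_mod_cast h

theorem productOperator_mulVec_productState (A : ∀ i, Matrix (B i) (B i) ℂ) (φ : ∀ i, B i → ℂ) :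
    productOperator A *ᵥ productState φ = productState fun i => A i *ᵥ φ i := by
  ext b
  simp only [productOperator, productState, mulVec, dotProduct, of_apply,
    ← Finset.prod_mul_distrib]
  exact (Fintype.prod_sum fun i d => A i (b i) d * φ i d).symm

theorem productOperator_mul (A A' : ∀ i, Matrix (B i) (B i) ℂ) :
    productOperator A * productOperator A' = productOperator fun i => A i * A' i := by
  ext b b'
  simp only [productOperator, mul_apply, of_apply, ← Finset.prod_mul_distrib]
  exact (Fintype.prod_sum fun i d => A i (b i) d * A' i d (b' i)).symm

theorem isStarProjection_productOperator {A : ∀ i, Matrix (B i) (B i) ℂ}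
    (hA : ∀ i, IsStarProjection (A i)) : IsStarProjection (productOperator A) where
  isIdempotentElem := by
    simp only [IsIdempotentElem, productOperator_mul, (hA _).isIdempotentElem.eq]
  isSelfAdjoint := by
    simp only [IsSelfAdjoint, star_productOperator, (hA _).isSelfAdjoint.star_eq]

end ProductStates

section SwapTest

theorem isStarProjection_half_smul_one_add {R : Type*} [Ring R] [StarRing R] [Algebra ℂ R]
    [StarModule ℂ R] {s : R} (hs : IsSelfAdjoint s) (hss : s * s = 1) :
    IsStarProjection ((1 / 2 : ℂ) • (1 + s)) where
  isIdempotentElem := by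
    simp only [IsIdempotentElem, smul_mul_smul_comm, add_mul, mul_add, one_mul, mul_one, hss]
    module
  isSelfAdjoint := by
    simp [isSelfAdjoint_iff, star_smul, hs.star_eq]

variable {V D : Type*} [DecidableEq V]

/-- The permutation of the basis vectors that exchanges the registers `u` and `v`. -/
def registerSwap (D : Type*) (u v : V) : Equiv.Perm (V → D) :=
  (Equiv.swap u v).arrowCongr (Equiv.refl D)

theorem registerSwap_apply (u v : V) (b : V → D) : registerSwap D u v b = b ∘ Equiv.swap u v :=
  rfl

theorem registerSwap_mul_self (u v : V) : registerSwap D u v * registerSwap D u v = 1 := by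
  ext b i
  simp [registerSwap_apply]

variable [Fintype V] [Fintype D] [DecidableEq D]

/-- The projection onto the states that are invariant under exchanging the registers `u` and `v`:
the accepting outcome of the swap test. -/
noncomputable def swapTest (u v : V) : Matrix (V → D) (V → D) ℂ :=
  (1 / 2 : ℂ) • (1 + (registerSwap D u v).permMatrix ℂ)

theorem isStarProjection_swapTest (u v : V) :
    IsStarProjection (swapTest u v : Matrix (V → D) (V → D) ℂ) := by
  refine isStarProjection_half_smul_one_add ?_ ?_
  · rw [IsSelfAdjoint, star_eq_conjTranspose, conjTranspose_permMatrix,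
      inv_eq_of_mul_eq_one_left (registerSwap_mul_self u v)]
  · rw [← permMatrix_mul, registerSwap_mul_self, permMatrix_one]

theorem swapTest_mulVec_productState (φ : V → D → ℂ) (u v : V) :
    swapTest u v *ᵥ productState φ =
      (1 / 2 : ℂ) • (productState φ + productState (φ ∘ Equiv.swap u v)) := by
  rw [swapTest, smul_mulVec, add_mulVec, one_mulVec, permMatrix_mulVec]
  congr 2
  ext b
  simp only [Function.comp_apply, productState, registerSwap_apply]
  rw [← Equiv.prod_comp (Equiv.swap u v) fun i => φ (Equiv.swap u v i) (b i)]
  simp only [Equiv.swap_apply_self]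

theorem swapTest_mulVec_productState_of_eq (φ : V → D → ℂ) {u v : V} (h : φ u = φ v) :
    swapTest u v *ᵥ productState φ = productState φ := by
  have hswap : φ ∘ Equiv.swap u v = φ := by
    rw [Equiv.comp_swap_eq_update]
    simp [h]
  rw [swapTest_mulVec_productState, hswap]
  module

theorem norm_swapTest_mulVec_productState_sq {φ : V → D → ℂ} (hφ : ∀ v, ‖toLp 2 (φ v)‖ = 1)
    {u v : V} (huv : u ≠ v) :
    ‖toLp 2 (swapTest u v *ᵥ productState φ)‖ ^ 2 = (1 + ‖star (φ u) ⬝ᵥ φ v‖ ^ 2) / 2 := by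
  have hself : star (productState φ) ⬝ᵥ productState φ = 1 := by
    simp [star_dotProduct_self, norm_productState, hφ]
  have hswap : star (productState φ) ⬝ᵥ productState (φ ∘ Equiv.swap u v) =
      (‖star (φ u) ⬝ᵥ φ v‖ ^ 2 : ℝ) := by
    have hrest : ∀ i ∈ Finset.univ, i ∉ ({u, v} : Finset V) →
        star (φ i) ⬝ᵥ (φ ∘ Equiv.swap u v) i = 1 := fun i _ hi => by
      simp only [Finset.mem_insert, Finset.mem_singleton, not_or] at hi
      rw [Function.comp_apply, Equiv.swap_apply_of_ne_of_ne hi.1 hi.2, star_dotProduct_self,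
        hφ, one_pow, Complex.ofReal_one]
    rw [star_productState_dotProduct, ← Finset.prod_subset (Finset.subset_univ {u, v}) hrest,
      Finset.prod_pair huv, Function.comp_apply, Function.comp_apply, Equiv.swap_apply_left,
      Equiv.swap_apply_right, ← star_star (φ u), star_dotProduct_star, star_star (φ u),
      Complex.star_def, Complex.mul_conj, Complex.normSq_eq_norm_sq]
  have hQ := isStarProjection_swapTest (D := D) u v
  rw [norm_toLp_mulVec_sq, ← star_eq_conjTranspose, hQ.isSelfAdjoint.star_eq,
    hQ.isIdempotentElem.eq, swapTest_mulVec_productState, dotProduct_smul, dotProduct_add, hself,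
    hswap]
  rw [show (1 / 2 : ℂ) • (1 + (‖star (φ u) ⬝ᵥ φ v‖ ^ 2 : ℝ) : ℂ) =
    ((1 + ‖star (φ u) ⬝ᵥ φ v‖ ^ 2) / 2 : ℝ) by push_cast; rw [smul_eq_mul]; ring,
    Complex.ofReal_re]

end SwapTest

section Fingerprints

open Polynomial

theorem card_filter_eval_eq_eval_lt {F : Type*} [Field F] [Fintype F] [DecidableEq F] {n : ℕ}
    {p q : F[X]} (hp : p.degree < n) (hq : q.degree < n) (hpq : p ≠ q) :
    Finset.card {a | p.eval a = q.eval a} < n := by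
  contrapose! hpq
  have hcard : (n : WithBot ℕ) ≤ Finset.card {a | p.eval a = q.eval a} := mod_cast hpq
  exact eq_of_degrees_lt_of_eval_finset_eq {a | p.eval a = q.eval a} (hp.trans_le hcard)
    (hq.trans_le hcard) (by simp)

section GraphState

variable {α β : Type*} [Fintype α] [Fintype β] [DecidableEq β]

/-- The uniform superposition of the basis vectors `(a, f a)` on the graph of `f`. -/
noncomputable def graphState (f : α → β) : α × β → ℂ :=
  fun z => if f z.1 = z.2 then ((√(Fintype.card α))⁻¹ : ℝ) else 0

theorem star_graphState_dotProduct (f g : α → β) :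
    star (graphState f) ⬝ᵥ graphState g = Finset.card {a | f a = g a} / Fintype.card α := by
  have hsq : ((√(Fintype.card α))⁻¹ : ℂ) * (√(Fintype.card α) : ℂ)⁻¹ = (Fintype.card α : ℂ)⁻¹ := by
    rw [← mul_inv, ← Complex.ofReal_mul, Real.mul_self_sqrt (Nat.cast_nonneg _),
      Complex.ofReal_natCast]
  have hrow : ∀ a, ∑ b, star (graphState f (a, b)) * graphState g (a, b) =
      if f a = g a then (Fintype.card α : ℂ)⁻¹ else 0 := fun a => by
    by_cases h : f a = g a <;> simp [graphState, hsq, h, eq_comm]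
  simp only [dotProduct, Pi.star_apply, Fintype.sum_prod_type, hrow, ← Finset.sum_filter,
    Finset.sum_const, nsmul_eq_mul, div_eq_mul_inv]

end GraphState

variable (F : Type*) [Field F] {n : ℕ} [DecidableEq F]

/-- The polynomial over `F` whose coefficients are the bits of `x`. -/
noncomputable def bitPolynomial (x : Fin n → Bool) : F[X] :=
  ofFn n fun i => if x i then 1 else 0

theorem bitPolynomial_injective : Function.Injective (bitPolynomial F : (Fin n → Bool) → F[X]) := by
  intro x y hxy
  ext i
  have hi := congrFun (injective_ofFn n hxy) i
  by_contra hne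
  cases hx : x i <;> cases hy : y i <;> simp_all

variable [Fintype F]

/-- The quantum fingerprint of a string: the superposition over all `a : F` of the positions `a` and
the letters at `a` of the Reed-Solomon encoding of the string. -/
noncomputable def fingerprint (x : Fin n → Bool) : F × F → ℂ :=
  graphState fun a => (bitPolynomial F x).eval a

theorem norm_fingerprint (x : Fin n → Bool) : ‖toLp 2 (fingerprint F x)‖ = 1 := by
  have hself : star (fingerprint F x) ⬝ᵥ fingerprint F x = 1 := by
    simp [fingerprint, star_graphState_dotProduct]
  rw [star_dotProduct_self] at hself
  exact (pow_eq_one_iff_of_nonneg (norm_nonneg _) two_ne_zero).1 (mod_cast hself)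

theorem norm_star_fingerprint_dotProduct_le {x y : Fin n → Bool} (hxy : x ≠ y) :
    ‖star (fingerprint F x) ⬝ᵥ fingerprint F y‖ ≤ n / Fintype.card F := by
  rw [fingerprint, fingerprint, star_graphState_dotProduct, norm_div, Complex.norm_natCast,
    Complex.norm_natCast]
  gcongr
  exact (card_filter_eval_eq_eval_lt (ofFn_degree_lt _) (ofFn_degree_lt _)
    ((bitPolynomial_injective F).ne hxy)).le

end Fingerprints

section EqualityMeasurement

variable {V D : Type*} [Fintype V] [DecidableEq V] [Fintype D]

/-- `M` copies of the joint state `productState φ`. -/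
def copies (M : ℕ) (φ : V → D → ℂ) : (Fin M → V → D) → ℂ := productState fun _ => productState φ

theorem norm_copies {M : ℕ} {φ : V → D → ℂ} (hφ : ∀ v, ‖toLp 2 (φ v)‖ = 1) :
    ‖toLp 2 (copies M φ)‖ = 1 := by
  simp only [copies, norm_productState, hφ, Finset.prod_const_one]

variable [DecidableEq D]

/-- The swap test of the registers `u` and `v` on `M` copies of a joint register, accepting if all
copies do. -/
noncomputable def repeatedSwapTest (D : Type*) [DecidableEq D] (M : ℕ) (u v : V) :
    Bool → Matrix (Fin M → V → D) (Fin M → V → D) ℂ :=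
  projectiveTest (productOperator fun _ => swapTest u v)

theorem norm_repeatedSwapTest_mulVec_copies_sub_le {M : ℕ} {φ : V → D → ℂ}
    (hφ : ∀ v, ‖toLp 2 (φ v)‖ = 1) {δ : ℝ} (hδ : δ < 1) {u v : V} {a : Bool}
    (htrue : a = true → φ u = φ v) (hfalse : a = false → ‖star (φ u) ⬝ᵥ φ v‖ ≤ δ) :
    ‖toLp 2 (repeatedSwapTest D M u v a *ᵥ copies M φ - copies M φ)‖ ≤ √((1 + δ ^ 2) / 2) ^ M := by
  cases a with
  | true =>
    simp only [repeatedSwapTest, projectiveTest, if_true, copies,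
      productOperator_mulVec_productState, swapTest_mulVec_productState_of_eq φ (htrue rfl),
      sub_self, toLp_zero, norm_zero]
    positivity
  | false =>
    have hoverlap := hfalse rfl
    have huv : u ≠ v := by
      rintro rfl
      simp only [star_dotProduct_self, hφ, one_pow, Complex.ofReal_one, norm_one] at hoverlap
      exact hδ.not_ge hoverlap
    simp only [repeatedSwapTest, projectiveTest, Bool.false_eq_true, if_false, sub_mulVec,
      one_mulVec, sub_sub_cancel_left, toLp_neg, norm_neg, copies,
      productOperator_mulVec_productState, norm_productState, Finset.prod_const, Finset.card_univ,
      Fintype.card_fin]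
    refine pow_le_pow_left₀ (norm_nonneg _) (Real.le_sqrt_of_sq_le ?_) M
    rw [norm_swapTest_mulVec_productState_sq hφ huv]
    gcongr

theorem exists_equality_measurement (V D : Type*) [Fintype V] [DecidableEq V] [Fintype D]
    [DecidableEq D] (M : ℕ) :
    ∃ A : (V × V → Bool) → Matrix (Fin M → V → D) (Fin M → V → D) ℂ, IsMeasurement A ∧
      ∀ φ : V → D → ℂ, (∀ v, ‖toLp 2 (φ v)‖ = 1) → ∀ δ < 1, ∀ w : V × V → Bool,
        (∀ u v, w (u, v) = true → φ u = φ v) →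
        (∀ u v, w (u, v) = false → ‖star (φ u) ⬝ᵥ φ v‖ ≤ δ) →
        ‖toLp 2 (A w *ᵥ copies M φ - copies M φ)‖ ≤
          Fintype.card V ^ 2 * √((1 + δ ^ 2) / 2) ^ M := by
  obtain ⟨A, hA, hdist⟩ := IsMeasurement.exists_sequential
    (fun z : V × V => repeatedSwapTest D M z.1 z.2) fun z => isMeasurement_projectiveTest
      (isStarProjection_productOperator fun _ => isStarProjection_swapTest z.1 z.2)
  refine ⟨A, hA, fun φ hφ δ hδ w htrue hfalse => (hdist w _).trans ?_⟩
  calc ∑ z, ‖toLp 2 (repeatedSwapTest D M z.1 z.2 (w z) *ᵥ copies M φ - copies M φ)‖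
      ≤ ∑ _z : V × V, √((1 + δ ^ 2) / 2) ^ M := Finset.sum_le_sum fun z _ =>
        norm_repeatedSwapTest_mulVec_copies_sub_le hφ hδ (htrue z.1 z.2) (hfalse z.1 z.2)
    _ = Fintype.card V ^ 2 * √((1 + δ ^ 2) / 2) ^ M := by
        rw [Finset.sum_const, Finset.card_univ, Fintype.card_prod, nsmul_eq_mul, Nat.cast_mul,
          sq (Fintype.card V : ℝ)]

end EqualityMeasurement

section Protocols

/-- The state of `q` qubits with amplitudes `φ`, where `e` encodes the register in `q` qubits. -/
noncomputable def QubitState.ofEquiv {B : Type*} [Fintype B] {q : ℕ} (e : QubitBasis q ≃ B)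
    (φ : B → ℂ) (hφ : ‖toLp 2 φ‖ = 1) : QubitState q where
  amp := toLp 2 (φ ∘ e)
  norm_amp := (norm_toLp_comp_equiv e φ).trans hφ

namespace QuantumSMP

variable {k n : ℕ} {S T : Type}

theorem outcomeProb_nonneg (P : QuantumSMP k n S) (x : Fin k → Fin n → Bool)
    (w : Fin P.outcomes) : 0 ≤ P.outcomeProb x w :=
  (P.effect_posSemidef w).re_dotProduct_nonneg _

theorem prob_mono (P : QuantumSMP k n S) (x : Fin k → Fin n → Bool) {good good' : S → Prop}
    (h : ∀ s, good s → good' s) : P.prob x good ≤ P.prob x good' := by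
  classical
  exact Finset.sum_le_sum_of_subset_of_nonneg (Finset.monotone_filter_right _ fun _ _ => h _)
    fun w _ _ => P.outcomeProb_nonneg x w

/-- The protocol `P` with its output processed by `f`. -/
def mapOutput (P : QuantumSMP k n S) (f : S → T) : QuantumSMP k n T where
  __ := P
  output := f ∘ P.output

theorem prob_le_prob_mapOutput (P : QuantumSMP k n S) (f : S → T) (x : Fin k → Fin n → Bool)
    {good : S → Prop} {good' : T → Prop} (h : ∀ s, good s → good' (f s)) :
    P.prob x good ≤ (P.mapOutput f).prob x good' :=
  P.prob_mono x h

section OfMeasurement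

variable {q : Fin k → ℕ} (message : ∀ l, (Fin n → Bool) → QubitState (q l)) {E Ω : Type}
  [Fintype E] [DecidableEq E] [Fintype Ω] (e : (∀ l, QubitBasis (q l)) ≃ E) {A : Ω → Matrix E E ℂ}
  (hA : IsMeasurement A)

open scoped ComplexOrder in
/-- The protocol in which the referee performs the measurement `A` on the joint register, whose
basis is relabelled by `e`, and outputs the outcome. -/
noncomputable def ofMeasurement : QuantumSMP k n Ω where
  qubits := q
  message := message
  outcomes := Fintype.card Ω
  effect w := ((A ((Fintype.equivFin Ω).symm w))ᴴ * A ((Fintype.equivFin Ω).symm w)).submatrix e e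
  effect_posSemidef w := (posSemidef_conjTranspose_mul_self _).submatrix e
  effect_sum := by
    rw [(Fintype.equivFin Ω).symm.sum_comp fun w => ((A w)ᴴ * A w).submatrix e e,
      ← submatrix_one_equiv e, ← hA]
    ext b b'
    simp only [Matrix.sum_apply, submatrix_apply]
  output := (Fintype.equivFin Ω).symm

theorem outcomeProb_ofMeasurement (x : Fin k → Fin n → Bool) (w : Ω) :
    (ofMeasurement message e hA).outcomeProb x (Fintype.equivFin Ω w) =
      ‖toLp 2 (A w *ᵥ (productState (fun l => ofLp (message l (x l)).amp) ∘ e.symm))‖ ^ 2 := by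
  set ψ := productState fun l => ofLp (message l (x l)).amp
  let A' := A ((Fintype.equivFin Ω).symm (Fintype.equivFin Ω w))
  change (star ψ ⬝ᵥ (A'ᴴ * A').submatrix e e *ᵥ ψ).re = _
  rw [show A' = A w from congrArg A ((Fintype.equivFin Ω).symm_apply_apply w),
    norm_toLp_mulVec_sq, submatrix_mulVec_equiv, ← comp_equiv_symm_dotProduct]
  rfl

theorem two_thirds_le_prob_ofMeasurement {x : Fin k → Fin n → Bool} {good : Ω → Prop} {w : Ω}
    (hw : good w) {ψ : E → ℂ}
    (hψ : productState (fun l => ofLp (message l (x l)).amp) ∘ e.symm = ψ)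
    (hdist : ‖toLp 2 (A w *ᵥ ψ - ψ)‖ ≤ 1 / 6) :
    2 / 3 ≤ (ofMeasurement message e hA).prob x good := by
  classical
  have hnorm : ‖toLp 2 ψ‖ = 1 := by
    rw [← hψ, norm_toLp_comp_equiv, norm_productState]
    simp only [toLp_ofLp, QubitState.norm_amp, Finset.prod_const_one]
  have htriangle := norm_sub_norm_le (toLp 2 ψ) (toLp 2 (A w *ᵥ ψ))
  rw [hnorm, norm_sub_rev, ← toLp_sub] at htriangle
  calc (2 / 3 : ℝ) ≤ (5 / 6) ^ 2 := by norm_num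
    _ ≤ ‖toLp 2 (A w *ᵥ ψ)‖ ^ 2 := by
        gcongr
        linarith
    _ = (ofMeasurement message e hA).outcomeProb x (Fintype.equivFin Ω w) := by
        rw [outcomeProb_ofMeasurement, hψ]
    _ ≤ (ofMeasurement message e hA).prob x good :=
        Finset.single_le_sum (fun w _ => outcomeProb_nonneg _ x w) <| Finset.mem_filter.2
          ⟨Finset.mem_univ _, by simpa only [ofMeasurement, Equiv.symm_apply_apply] using hw⟩

end OfMeasurement

theorem exists_cost_eq_zero (s : S) : ∃ P : QuantumSMP k n S, P.cost = 0 ∧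
    ∀ x (good : S → Prop), good s → 2 / 3 ≤ P.prob x good := by
  let P : QuantumSMP k n Unit := ofMeasurement (q := fun _ => 0) (A := fun _ => 1)
    (fun _ _ => QubitState.ofEquiv (Equiv.refl _) 1 (by simp [PiLp.norm_eq_of_L2]))
    (Equiv.refl _) (by simp [IsMeasurement])
  refine ⟨P.mapOutput fun _ => s, Finset.sum_const_zero, fun x good hs => ?_⟩
  refine le_trans ?_ (P.prob_le_prob_mapOutput (good := fun _ => True) _ x fun _ _ => hs)
  exact two_thirds_le_prob_ofMeasurement _ _ _ (w := ()) trivial rfl (by simp)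

section EqualityProtocol

variable {r M : ℕ} {D Q X : Type*}

/-- When each of `k` players sends `M` copies of `r` registers, the referee regroups what it
receives as `M` copies of `k * r` registers. -/
def regroup (k : ℕ) (e : Q ≃ (Fin M → Fin r → D)) : (Fin k → Q) ≃ (Fin M → Fin k × Fin r → D) :=
  (Equiv.piCongrRight fun _ => e).trans ((Equiv.piComm _).trans
    (Equiv.piCongrRight fun _ => (Equiv.curry _ _ _).symm))

theorem productState_copies_comp_regroup_symm (e : Q ≃ (Fin M → Fin r → D))
    (φ : Fin k → Fin r → D → ℂ) :
    productState (fun l => copies M (φ l) ∘ e) ∘ (regroup k e).symm =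
      copies M fun v : Fin k × Fin r => φ v.1 v.2 := by
  ext b
  have hsymm : ∀ l, e ((regroup k e).symm b l) = fun c j => b c (l, j) := fun l =>
    e.apply_symm_apply _
  simp only [Function.comp_apply, copies, productState, hsymm, Fintype.prod_prod_type]
  exact Finset.prod_comm

/-- The family of all strings `f l j (x l)` that the players compute from their inputs. -/
def derivedStrings (f : Fin k → Fin r → (Fin n → Bool) → X) (x : Fin k → Fin n → Bool) :
    Fin k × Fin r → X :=
  fun v => f v.1 v.2 (x v.1)

theorem sqrt_five_eighths_pow_le (t : ℕ) :
    √((1 + (1 / 2) ^ 2) / 2) ^ (4 * t) ≤ ((2 : ℝ) ^ t)⁻¹ := by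
  rw [pow_mul, ← inv_pow]
  gcongr
  rw [show 4 = 2 * 2 from rfl, pow_mul, Real.sq_sqrt (by positivity)]
  norm_num

theorem exists_equality_protocol {m s t : ℕ} (hs : s ≠ 0) (hms : 2 * m ≤ 2 ^ s)
    (ht : 6 * (k * r) ^ 2 ≤ 2 ^ t) (f : Fin k → Fin r → (Fin n → Bool) → Fin m → Bool) :
    ∃ P : QuantumSMP k n ((Fin k × Fin r) × (Fin k × Fin r) → Bool),
      P.cost = k * (4 * t * (r * (2 * s))) ∧
      P.Solves fun x R => ∀ u v, R (u, v) = true ↔ derivedStrings f x u = derivedStrings f x v := by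
  classical
  let F := GaloisField 2 s
  have := Fintype.ofFinite F
  have hF : Fintype.card F = 2 ^ s := by
    rw [Fintype.card_eq_nat_card, GaloisField.card 2 s hs]
  let e : QubitBasis (4 * t * (r * (2 * s))) ≃ (Fin (4 * t) → Fin r → F × F) :=
    Fintype.equivOfCardEq (by simp [hF, ← pow_add, ← pow_mul]; ring_nf)
  obtain ⟨A, hA, hdist⟩ := exists_equality_measurement (Fin k × Fin r) (F × F) (4 * t)
  let φ (l : Fin k) (x : Fin n → Bool) (j : Fin r) : F × F → ℂ := fingerprint F (f l j x)
  have hφ : ∀ l x, ‖toLp 2 (copies (4 * t) (φ l x))‖ = 1 := fun l x =>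
    norm_copies fun _ => norm_fingerprint F _
  refine ⟨ofMeasurement (fun l x => QubitState.ofEquiv e (copies (4 * t) (φ l x)) (hφ l x))
    (regroup k e) hA, by simp [cost, ofMeasurement], fun x => ?_⟩
  let y := derivedStrings f x
  refine two_thirds_le_prob_ofMeasurement _ _ hA (w := fun z => decide (y z.1 = y z.2))
    (fun u v => decide_eq_true_iff) (productState_copies_comp_regroup_symm e fun l => φ l (x l)) ?_
  refine (hdist _ (fun _ => norm_fingerprint F _) (1 / 2) (by norm_num) _ (fun u v huv => ?_)
    fun u v huv => ?_).trans ?_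
  · exact congrArg (fingerprint F) (of_decide_eq_true huv)
  · refine (norm_star_fingerprint_dotProduct_le F (of_decide_eq_false huv)).trans ?_
    rw [hF, div_le_div_iff₀ (by positivity) (by positivity)]
    exact_mod_cast show m * 2 ≤ 1 * 2 ^ s by omega
  · have ht' : (6 * (k * r) ^ 2 : ℝ) ≤ 2 ^ t := mod_cast ht
    rw [Fintype.card_prod, Fintype.card_fin, Fintype.card_fin, Nat.cast_mul]
    calc ((k * r : ℝ) ^ 2 * √((1 + (1 / 2) ^ 2) / 2) ^ (4 * t))
        ≤ (k * r) ^ 2 * (2 ^ t)⁻¹ := by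
          gcongr
          exact sqrt_five_eighths_pow_le t
      _ ≤ 1 / 6 := by
          rw [← div_eq_mul_inv, div_le_div_iff₀ (by positivity) (by norm_num)]
          linarith

end EqualityProtocol

end QuantumSMP
end Protocols

section InducedPaths

variable {V : Type*} (G : SimpleGraph V)

theorem nonempty_pathGraph_three_embedding_iff :
    Nonempty (SimpleGraph.pathGraph 3 ↪g G) ↔ ¬ Gᶜ.IsCompleteMultipartite := by
  rw [SimpleGraph.Embedding.complEquiv.nonempty_congr]
  exact ⟨fun ⟨f⟩ => SimpleGraph.not_isCompleteMultipartite_of_pathGraph3ComplEmbedding f,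
    fun h => ⟨SimpleGraph.pathGraph3ComplEmbeddingOf h⟩⟩

/-- The closed neighborhood of a node: the node together with its neighbors. -/
def closedNeighborSet (v : V) : Set V := insert v (G.neighborSet v)

theorem isCompleteMultipartite_compl_iff_closedNeighborSet_eq :
    Gᶜ.IsCompleteMultipartite ↔
      ∀ v, ∀ u ∈ closedNeighborSet G v, closedNeighborSet G u = closedNeighborSet G v := by
  have hmem : ∀ u v, ¬ Gᶜ.Adj u v ↔ v ∈ closedNeighborSet G u := fun u v => by
    simp [closedNeighborSet, SimpleGraph.compl_adj, or_iff_not_imp_left, eq_comm]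
  have hsymm : ∀ {u v}, v ∈ closedNeighborSet G u → u ∈ closedNeighborSet G v := fun h => by
    rwa [← hmem, SimpleGraph.adj_comm, hmem]
  refine ⟨fun h v u huv => Set.ext fun w => ?_, fun h => ⟨fun u v w huv hvw => ?_⟩⟩
  · have htrans : ∀ {a b c}, b ∈ closedNeighborSet G a → c ∈ closedNeighborSet G b →
        c ∈ closedNeighborSet G a := fun hab hbc =>
      (hmem _ _).1 (h.trans _ _ _ ((hmem _ _).2 hab) ((hmem _ _).2 hbc))
    exact ⟨htrans huv, htrans (hsymm huv)⟩
  · rw [hmem] at *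
    rwa [← h u v huv]

open Classical in
theorem isCompleteMultipartite_compl_iff_card [Fintype V] :
    Gᶜ.IsCompleteMultipartite ↔ ∀ v,
      Finset.card {u | closedNeighborSet G u = closedNeighborSet G v} = G.degree v + 1 := by
  rw [isCompleteMultipartite_compl_iff_closedNeighborSet_eq]
  refine forall_congr' fun v => ?_
  have hmem : ∀ u, u ∈ closedNeighborSet G v ↔ u ∈ insert v (G.neighborFinset v) := fun u => by
    simp [closedNeighborSet]
  have hsub : ({u | closedNeighborSet G u = closedNeighborSet G v} : Finset V) ⊆
      insert v (G.neighborFinset v) := fun u hu => by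
    rw [← hmem, ← (Finset.mem_filter.1 hu).2]
    exact Set.mem_insert u _
  have hcard : (insert v (G.neighborFinset v)).card = G.degree v + 1 :=
    Finset.card_insert_of_notMem (G.notMem_neighborFinset_self v)
  rw [← hcard]
  refine ⟨fun h => congrArg Finset.card (hsub.antisymm fun u hu => ?_), fun h u hu => ?_⟩
  · exact Finset.mem_filter.2 ⟨Finset.mem_univ u, h u ((hmem u).2 hu)⟩
  · rw [hmem, ← Finset.eq_of_subset_of_card_le hsub h.ge] at hu
    exact (Finset.mem_filter.1 hu).2

end InducedPaths

section EqualityProblems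

variable {k n : ℕ} {S : Type}

/-- A problem with at least one correct output on every input, for which the set of correct outputs
depends only on which of the inputs are equal. -/
structure IsEqualityProblem (correct : (Fin k → Fin n → Bool) → S → Prop) : Prop where
  exists_correct : ∀ x, ∃ s, correct x s
  congr : ∀ {x y s}, (∀ i j, x i = x j ↔ y i = y j) → correct x s → correct y s

theorem isEqualityProblem_isGroupByEQ : IsEqualityProblem (IsGroupByEQ (k := k) (n := n)) where
  exists_correct x := by
    classical
    refine ⟨Finpartition.ofSetoid (Setoid.ker x), fun i j => ?_⟩
    rw [← Finpartition.mem_part_iff_exists, Finpartition.mem_part_ofSetoid_iff_rel, Setoid.ker_def,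
      eq_comm]
  congr h hQ i j := (hQ i j).trans (h i j)

theorem isEqualityProblem_isAllEQ : IsEqualityProblem (IsAllEQ (k := k) (n := n)) where
  exists_correct x := by
    classical
    exact ⟨decide _, decide_eq_true_iff⟩
  congr h hb := by simpa only [IsAllEQ, h] using hb

theorem isEqualityProblem_isExistsEQ : IsEqualityProblem (IsExistsEQ (k := k) (n := n)) where
  exists_correct x := by
    classical
    exact ⟨decide _, decide_eq_true_iff⟩
  congr h hb := by simpa only [IsExistsEQ, h] using hb

theorem frequencyMoment_eq_sum (p : ℝ) (x : Fin k → Fin n → Bool) :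
    frequencyMoment p x = ∑ l, (frequency x (x l) : ℝ) ^ p / frequency x (x l) := by
  have hfiber : ∀ w, ∑ l with x l = w, (frequency x (x l) : ℝ) ^ p / frequency x (x l) =
      frequency x w * ((frequency x w : ℝ) ^ p / frequency x w) := fun w => by
    rw [frequency, ← nsmul_eq_mul]
    exact Finset.sum_eq_card_nsmul fun l hl => by rw [(Finset.mem_filter.1 hl).2, frequency]
  rw [← Finset.sum_fiberwise Finset.univ x, frequencyMoment, Finset.sum_filter]
  refine Finset.sum_congr rfl fun w _ => ?_
  rw [hfiber]
  split_ifs with hw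
  · rw [mul_div_cancel₀]
    exact_mod_cast hw
  · rw [not_not.1 hw, Nat.cast_zero, zero_mul]

theorem isEqualityProblem_frequencyMoment (p : ℝ) :
    IsEqualityProblem fun (x : Fin k → Fin n → Bool) s => s = frequencyMoment p x where
  exists_correct x := ⟨_, rfl⟩
  congr h hs := by simpa only [frequencyMoment_eq_sum, frequency, h] using hs

theorem IsEqualityProblem.exists_solves_mapOutput {correct : (Fin k → Fin n → Bool) → S → Prop}
    (hcorrect : IsEqualityProblem correct) {V : Type} (a : Fin k → V)
    (P : QuantumSMP k n (V × V → Bool))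
    (hP : P.Solves fun x R => ∀ i j, R (a i, a j) = true ↔ x i = x j) :
    ∃ g, (P.mapOutput g).Solves correct := by
  have : Nonempty S := ⟨(hcorrect.exists_correct fun _ _ => true).choose⟩
  let consistent (R : V × V → Bool) (s : S) : Prop :=
    ∃ y, (∀ i j, R (a i, a j) = true ↔ y i = y j) ∧ correct y s
  refine ⟨fun R => Classical.epsilon (consistent R), fun x =>
    (hP x).trans (P.prob_le_prob_mapOutput _ x fun R hR => ?_)⟩
  obtain ⟨s, hs⟩ := hcorrect.exists_correct x
  obtain ⟨y, hy, hcorrect_y⟩ := Classical.epsilon_spec (p := consistent R) ⟨s, x, hR, hs⟩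
  exact hcorrect.congr (fun i j => (hy i j).symm.trans (hR i j)) hcorrect_y

end EqualityProblems

section CommunicationCost

theorem one_le_logb_two_natCast {n : ℕ} (hn : 2 ≤ n) : 1 ≤ Real.logb 2 n := by
  rw [Real.le_logb_iff_rpow_le one_lt_two (by positivity), Real.rpow_one]
  exact_mod_cast hn

theorem natCast_clog_two_le_two_mul_logb {n : ℕ} (hn : 2 ≤ n) :
    (Nat.clog 2 n : ℝ) ≤ 2 * Real.logb 2 n := by
  have hlog := one_le_logb_two_natCast hn
  rw [← Real.natCeil_logb_natCast, Nat.cast_ofNat]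
  linarith [Nat.ceil_lt_add_one (zero_le_one.trans hlog)]

theorem natCast_mul_log_mul_log_nonneg (k n : ℕ) : (0 : ℝ) ≤ k * Real.log k * Real.log n :=
  mul_nonneg (mul_nonneg (Nat.cast_nonneg k) (Real.log_natCast_nonneg k))
    (Real.log_natCast_nonneg n)

namespace QuantumSMP

theorem exists_equality_protocol_cost_le {r : ℕ} (hr : 0 < r) :
    ∃ C : ℝ, 0 < C ∧ ∀ {k n m : ℕ}, 2 ≤ k → 2 ≤ m →
      ∀ f : Fin k → Fin r → (Fin n → Bool) → Fin m → Bool,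
      ∃ P : QuantumSMP k n ((Fin k × Fin r) × (Fin k × Fin r) → Bool),
        P.Solves (fun x R => ∀ u v,
          R (u, v) = true ↔ derivedStrings f x u = derivedStrings f x v) ∧
        (P.cost : ℝ) ≤ C * (k * Real.log k * Real.log m) := by
  let c := Nat.clog 2 (6 * r ^ 2)
  refine ⟨24 * r * (c + 4) / Real.log 2 ^ 2, by positivity, fun {k n m} hk hm f => ?_⟩
  have hclog : ∀ a, a ≤ 2 ^ Nat.clog 2 a := Nat.le_pow_clog one_lt_two
  obtain ⟨P, hcost, hP⟩ := exists_equality_protocol (s := 1 + Nat.clog 2 m)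
    (t := c + 2 * Nat.clog 2 k) (by omega)
    (by rw [pow_add, pow_one]; exact Nat.mul_le_mul_left _ (hclog m))
    (calc 6 * (k * r) ^ 2 = 6 * r ^ 2 * k ^ 2 := by ring
      _ ≤ 2 ^ c * (2 ^ Nat.clog 2 k) ^ 2 := by gcongr <;> exact hclog _
      _ = 2 ^ (c + 2 * Nat.clog 2 k) := by rw [← pow_mul, ← pow_add, mul_comm 2]) f
  refine ⟨P, hP, ?_⟩
  have hrepetitions : (c + 2 * Nat.clog 2 k : ℝ) ≤ (c + 4) * Real.logb 2 k := by
    nlinarith [natCast_clog_two_le_two_mul_logb hk, one_le_logb_two_natCast hk,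
      Nat.cast_nonneg (α := ℝ) c]
  have hfingerprint : (1 + Nat.clog 2 m : ℝ) ≤ 3 * Real.logb 2 m := by
    linarith [natCast_clog_two_le_two_mul_logb hm, one_le_logb_two_natCast hm]
  calc (P.cost : ℝ) = 8 * r * k * ((c + 2 * Nat.clog 2 k) * (1 + Nat.clog 2 m)) := by
        rw [hcost]
        push_cast
        ring
    _ ≤ 8 * r * k * ((c + 4) * Real.logb 2 k * (3 * Real.logb 2 m)) := by
        gcongr
        exact (by positivity : (0 : ℝ) ≤ c + 2 * Nat.clog 2 k).trans hrepetitions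
    _ = 24 * r * (c + 4) / Real.log 2 ^ 2 * (k * Real.log k * Real.log m) := by
        simp only [Real.logb]
        field_simp
        ring

theorem exists_solves_of_isEqualityProblem :
    ∃ C : ℝ, 0 < C ∧ ∀ {k n : ℕ}, 2 ≤ n →
      ∀ {S : Type} {correct : (Fin k → Fin n → Bool) → S → Prop}, IsEqualityProblem correct →
      ∃ P : QuantumSMP k n S, P.Solves correct ∧
        (P.cost : ℝ) ≤ C * (k * Real.log k * Real.log n) := by
  obtain ⟨C, hC, hequality⟩ := exists_equality_protocol_cost_le one_pos
  refine ⟨C, hC, fun {k n} hn {S correct} hcorrect => ?_⟩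
  rcases le_or_gt 2 k with hk | hk
  · obtain ⟨P, hP, hcost⟩ := hequality hk hn fun _ _ x => x
    obtain ⟨g, hg⟩ := hcorrect.exists_solves_mapOutput (fun i => (i, 0)) P fun x =>
      (hP x).trans (P.prob_mono x fun R hR i j => hR (i, 0) (j, 0))
    exact ⟨P.mapOutput g, hg, hcost⟩
  · have := Fin.subsingleton_iff_le_one.2 (Nat.le_of_lt_succ hk)
    obtain ⟨s, hs⟩ := hcorrect.exists_correct fun _ _ => true
    obtain ⟨P, hcost, hP⟩ := exists_cost_eq_zero (k := k) (n := n) s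
    refine ⟨P, fun x => hP x _ (hcorrect.congr (fun i j => ?_) hs), ?_⟩
    · simp only [Subsingleton.elim i j]
    · simpa only [hcost, Nat.cast_zero] using
        mul_nonneg hC.le (natCast_mul_log_mul_log_nonneg k n)

end QuantumSMP
end CommunicationCost

section NumberInHand

/-- The strings from which the referee recognizes an induced path: the player `v` with
neighborhood vector `y` contributes the indicators of its closed neighborhood, of the number that is
its degree, and of its own name. Comparing the last two kinds tells the referee the degrees. -/
def inducedPathStrings {k : ℕ} (v : Fin k) : Fin 3 → (Fin k → Bool) → Fin k → Bool :=
  ![fun y => Function.update y v true,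
    fun y u => decide (u.val = Finset.card {w | y w = true}),
    fun _ u => decide (u = v)]

variable {k : ℕ} (G : SimpleGraph (Fin k))

theorem derivedStrings_inducedPathStrings_zero_eq_iff (u v : Fin k) :
    QuantumSMP.derivedStrings inducedPathStrings (neighborhoodVector G) (u, 0) =
        QuantumSMP.derivedStrings inducedPathStrings (neighborhoodVector G) (v, 0) ↔
      closedNeighborSet G u = closedNeighborSet G v := by
  classical
  have hstring : ∀ v, QuantumSMP.derivedStrings inducedPathStrings (neighborhoodVector G) (v, 0) =
      fun w => decide (w ∈ closedNeighborSet G v) := fun v => by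
    ext w
    by_cases hwv : w = v <;>
      simp [QuantumSMP.derivedStrings, inducedPathStrings, neighborhoodVector, closedNeighborSet,
        hwv]
  simp only [hstring, funext_iff, decide_eq_decide, Set.ext_iff]

open Classical in
theorem derivedStrings_inducedPathStrings_one_eq_two_iff (v d : Fin k) :
    QuantumSMP.derivedStrings inducedPathStrings (neighborhoodVector G) (v, 1) =
        QuantumSMP.derivedStrings inducedPathStrings (neighborhoodVector G) (d, 2) ↔
      G.degree v = d := by
  have hdegree : Finset.card {w | neighborhoodVector G v w = true} = G.degree v := by
    simp [neighborhoodVector, ← SimpleGraph.card_neighborFinset_eq_degree,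
      SimpleGraph.neighborFinset_eq_filter]
  simp only [QuantumSMP.derivedStrings, inducedPathStrings, funext_iff, Matrix.cons_val, hdegree,
    decide_eq_decide, ← Fin.val_inj]
  exact ⟨fun h => ((h d).2 rfl).symm, fun h u => by rw [h]⟩

/-- The output of the referee who has learned which of the strings `inducedPathStrings` are equal:
an induced path exists unless every node `v` of degree `d` shares its closed neighborhood with
exactly `d + 1` nodes. -/
def inducedPathAnswer (R : (Fin k × Fin 3) × (Fin k × Fin 3) → Bool) : Bool :=
  !decide (∀ v d : Fin k, R ((v, 1), (d, 2)) = true →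
    Finset.card {u : Fin k | R ((u, 0), (v, 0)) = true} = d.val + 1)

theorem isInducedP3Answer_inducedPathAnswer {R : (Fin k × Fin 3) × (Fin k × Fin 3) → Bool}
    (hR : ∀ u v, R (u, v) = true ↔
      QuantumSMP.derivedStrings inducedPathStrings (neighborhoodVector G) u =
        QuantumSMP.derivedStrings inducedPathStrings (neighborhoodVector G) v) :
    IsInducedP3Answer G (inducedPathAnswer R) := by
  classical
  rw [IsInducedP3Answer, nonempty_pathGraph_three_embedding_iff,
    isCompleteMultipartite_compl_iff_card, inducedPathAnswer, Bool.not_eq_true',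
    decide_eq_false_iff_not, not_iff_not]
  simp only [hR, derivedStrings_inducedPathStrings_zero_eq_iff,
    derivedStrings_inducedPathStrings_one_eq_two_iff]
  refine forall_congr' fun v => ⟨fun h => ?_, fun h d hd => hd ▸ h⟩
  exact h ⟨G.degree v, by simpa using G.degree_lt_card_verts v⟩ rfl

theorem isInducedP3Answer_false [Subsingleton (Fin k)] : IsInducedP3Answer G false := by
  refine iff_of_false Bool.false_ne_true fun ⟨e⟩ => ?_
  exact zero_ne_one (e.injective (Subsingleton.elim (e 0) (e 1)))

theorem exists_solvesNIH_isInducedP3Answer :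
    ∃ C : ℝ, 0 < C ∧ ∀ k : ℕ, ∃ P : QuantumSMP k k Bool,
      P.SolvesNIH IsInducedP3Answer ∧ (P.cost : ℝ) ≤ C * (k * Real.log k * Real.log k) := by
  obtain ⟨C, hC, hequality⟩ := QuantumSMP.exists_equality_protocol_cost_le three_pos
  refine ⟨C, hC, fun k => ?_⟩
  rcases le_or_gt 2 k with hk | hk
  · obtain ⟨P, hP, hcost⟩ := hequality hk hk inducedPathStrings
    exact ⟨P.mapOutput inducedPathAnswer, fun G => (hP _).trans
      (P.prob_le_prob_mapOutput _ _ fun R => isInducedP3Answer_inducedPathAnswer G), hcost⟩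
  · have := Fin.subsingleton_iff_le_one.2 (Nat.le_of_lt_succ hk)
    obtain ⟨P, hcost, hP⟩ := QuantumSMP.exists_cost_eq_zero (k := k) (n := k) false
    refine ⟨P, fun G => hP _ _ (isInducedP3Answer_false G), ?_⟩
    simpa only [hcost, Nat.cast_zero] using
      mul_nonneg hC.le (natCast_mul_log_mul_log_nonneg k k)

end NumberInHand

theorem mainTheorem5_general :
    ∃ C : ℝ, 0 < C ∧
      (∀ k n : ℕ, 2 ≤ n → ∀ (S : Type) (correct : (Fin k → Fin n → Bool) → S → Prop),
        IsEqualityProblem correct →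
        ∃ P : QuantumSMP k n S,
          P.Solves correct ∧ (P.cost : ℝ) ≤ C * (k * Real.log k * Real.log n)) ∧
      (∀ k : ℕ,
        ∃ P : QuantumSMP k k Bool,
          P.SolvesNIH IsInducedP3Answer ∧ (P.cost : ℝ) ≤ C * (k * Real.log k ^ 2)) := by
  obtain ⟨C₁, hC₁, hequality⟩ := QuantumSMP.exists_solves_of_isEqualityProblem
  obtain ⟨C₂, -, hinducedPath⟩ := exists_solvesNIH_isInducedP3Answer
  refine ⟨max C₁ C₂, lt_max_of_lt_left hC₁, fun k n hn S correct hcorrect => ?_, fun k => ?_⟩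
  · obtain ⟨P, hP, hcost⟩ := hequality hn hcorrect
    exact ⟨P, hP, hcost.trans <|
      mul_le_mul_of_nonneg_right (le_max_left _ _) (natCast_mul_log_mul_log_nonneg k n)⟩
  · obtain ⟨P, hP, hcost⟩ := hinducedPath k
    rw [pow_two, ← mul_assoc (k : ℝ)]
    exact ⟨P, hP, hcost.trans <|
      mul_le_mul_of_nonneg_right (le_max_right _ _) (natCast_mul_log_mul_log_nonneg k k)⟩

theorem mainTheorem5 :
    ∃ C : ℝ, 0 < C ∧
      (∀ k n : ℕ, 2 ≤ n →
        (∃ P : QuantumSMP k n (Finpartition (Finset.univ : Finset (Fin k))),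
          P.Solves IsGroupByEQ ∧ (P.cost : ℝ) ≤ C * (k * Real.log k * Real.log n)) ∧
        (∃ P : QuantumSMP k n Bool,
          P.Solves IsAllEQ ∧ (P.cost : ℝ) ≤ C * (k * Real.log k * Real.log n)) ∧
        (∃ P : QuantumSMP k n Bool,
          P.Solves IsExistsEQ ∧ (P.cost : ℝ) ≤ C * (k * Real.log k * Real.log n)) ∧
        (∀ p : ℝ, 0 ≤ p →
          ∃ P : QuantumSMP k n ℝ,
            P.Solves (fun x s => s = frequencyMoment p x) ∧
              (P.cost : ℝ) ≤ C * (k * Real.log k * Real.log n))) ∧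
      (∀ k : ℕ,
        ∃ P : QuantumSMP k k Bool,
          P.SolvesNIH IsInducedP3Answer ∧ (P.cost : ℝ) ≤ C * (k * Real.log k ^ 2)) := by
  obtain ⟨C, hC, hequality, hinducedPath⟩ := mainTheorem5_general
  refine ⟨C, hC, fun k n hn => ?_, hinducedPath⟩
  exact ⟨hequality k n hn _ _ isEqualityProblem_isGroupByEQ,
    hequality k n hn _ _ isEqualityProblem_isAllEQ,
    hequality k n hn _ _ isEqualityProblem_isExistsEQ,
    fun p _ => hequality k n hn _ _ (isEqualityProblem_frequencyMoment p)⟩
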